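/- Let $X\subset\mathbb R^n$ be nonempty and compact, let $C(X)$ be the bounded continuous real functions on $X$ with the sup norm, and let $\mathcal M(X)$ be the finite signed Borel measures on $X$ with the weak topology induced by $C(X)$ through the pairing $\langle f,\mu\rangle=\int_X f\,d\mu$. Let $\nu$ be a Borel probability measure on $\mathbb R^n$ with $\int|y|\,d\nu(y)<\infty$. For $f\in C(X)$ put $$f^\star(y)=\sup_{x\in X}\big[\langle x,y\rangle-f(x)\big]\quad(y\in\mathbb R^n),\qquad J_\nu(f)=\int f^\star\,d\nu .$$ For a Borel probability measure $\mu$ on $X$ put $$W_2^2(\mu,\nu)=\inf_{\gamma\in\Pi(\mu,\nu)}\int-\langle x,y\rangle\,d\gamma(x,y),$$ where $\Pi(\mu,\nu)$ is the set of Borel probability measures on $X\times\mathbb R^n$ with marginals $\mu$ and $\nu$, and put $W_2^2(\mu,\nu)=+\infty$ for all other $\mu\in\mathcal M(X)$. Then $f^\star$ is finite and $\nu$-integrable for every $f\in C(X)$; for every probability measure $\mu$ on $X$, the function $\langle x,y\rangle$ is integrable with respect to every $\gamma\in\Pi(\mu,\nu)$ and $W_2^2(\mu,\nu)$ is finite;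 and the following hold. 1. $J_\nu:C(X)\to\mathbb R$ and $W_2^2(-\,\cdot\,,\nu):\mathcal M(X)\to(-\infty,+\infty]$ are convex and lower semicontinuous. 2. They are Legendre dual to each other: for every $\mu\in\mathcal M(X)$ and every $f\in C(X)$, $$\sup_{g\in C(X)}\big[\langle g,\mu\rangle-J_\nu(g)\big]=W_2^2(-\mu,\nu),\qquad \sup_{\lambda\in\mathcal M(X)}\big[\langle f,\lambda\rangle-W_2^2(-\lambda,\nu)\big]=J_\nu(f).$$ 3. Let $f\in C(X)$ be such that $f^\star$ is differentiable $\nu$-almost everywhere; if $\nu$ is absolutely continuous with respect to Lebesgue measure, this is the case for every $f\in C(X)$. Then $\mathrm{MA}_\nu f:=(\nabla f^\star)_\#\nu$ is a probability measure on $X$, and $J_\nu$ is Gateaux differentiable at $f$ with derivative $dJ_\nu|_f=-\mathrm{MA}_\nu f$, that is, $$\frac{d}{dt}\Big|_{t=0}J_\nu(f+tg)=-\int_X g\,d(\mathrm{MA}_\nu f)\qquad\text{for all } g\in C(X).$$ -/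

import Mathlib

open MeasureTheory Set
open scoped BoundedContinuousFunction

noncomputable section

/-- The real-valued transform `f^⋆(y) = sup_{x ∈ X} (⟨x, y⟩ - f(x))`, a function on all of `ℝⁿ`,
of a function `f` on a set `X ⊆ ℝⁿ`. -/
def legendreOn {n : ℕ} (X : Set (EuclideanSpace ℝ (Fin n))) (f : X → ℝ)
    (y : EuclideanSpace ℝ (Fin n)) : ℝ :=
  ⨆ x : X, (inner ℝ (x : EuclideanSpace ℝ (Fin n)) y - f x)

/-- The functional `J_ν(f) = ∫ f^⋆ dν` on bounded continuous functions on `X`. -/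
def JFunctional {n : ℕ} (X : Set (EuclideanSpace ℝ (Fin n)))
    (ν : Measure (EuclideanSpace ℝ (Fin n))) (f : X →ᵇ ℝ) : ℝ :=
  ∫ y, legendreOn X f y ∂ν

/-- The transport plans between `μ` and `ν`: probability measures on the product with
marginals `μ` and `ν`. -/
def transportPlans {S T : Type*} [MeasurableSpace S] [MeasurableSpace T]
    (μ : Measure S) (ν : Measure T) : Set (Measure (S × T)) :=
  {γ | IsProbabilityMeasure γ ∧ γ.map Prod.fst = μ ∧ γ.map Prod.snd = ν}

/-- The transport cost function `c(x, y) = -⟨x, y⟩` on `X × ℝⁿ`. -/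
def innerCost {n : ℕ} (X : Set (EuclideanSpace ℝ (Fin n)))
    (p : X × EuclideanSpace ℝ (Fin n)) : ℝ :=
  -inner ℝ (p.1 : EuclideanSpace ℝ (Fin n)) p.2

/-- The optimal transport functional `W_2^2(μ, ν)` for the cost `-⟨x, y⟩`, when `μ` is a
probability measure on `X`: the infimum of `∫ c dγ` over the transport plans `γ`. -/
def transportCost {n : ℕ} (X : Set (EuclideanSpace ℝ (Fin n))) (μ : Measure X)
    (ν : Measure (EuclideanSpace ℝ (Fin n))) : EReal :=
  ⨅ γ ∈ transportPlans μ ν, ((∫ p, innerCost X p ∂γ : ℝ) : EReal)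

open Classical in
/-- `W_2^2(·, ν)` extended by `+∞` to all finite signed Borel measures on `X`: its value at `μ`
is the optimal transport functional if `μ` is a probability measure, and `+∞` otherwise. -/
def W22 {n : ℕ} (X : Set (EuclideanSpace ℝ (Fin n)))
    (ν : Measure (EuclideanSpace ℝ (Fin n))) (μ : SignedMeasure X) : EReal :=
  if h : ∃ m : ProbabilityMeasure X, (m : Measure X).toSignedMeasure = μ then
    transportCost X (h.choose : Measure X) ν
  else ⊤

/-- On a probability measure, `W22` is the optimal transport functional. -/
theorem W22_probabilityMeasure {n : ℕ} (X : Set (EuclideanSpace ℝ (Fin n)))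
    (ν : Measure (EuclideanSpace ℝ (Fin n))) (m : ProbabilityMeasure X) :
    W22 X ν (m : Measure X).toSignedMeasure = transportCost X m ν := by
  have h : ∃ m' : ProbabilityMeasure X,
      (m' : Measure X).toSignedMeasure = (m : Measure X).toSignedMeasure := ⟨m, rfl⟩
  have h2 : (h.choose : Measure X) = m := Measure.toSignedMeasure_eq_toSignedMeasure_iff.mp h.choose_spec
  rw [W22, dif_pos h, h2]

/-- The integration pairing `⟨f, μ⟩ = ∫ f dμ` between bounded continuous functions and finite
signed measures. -/
def measurePairing {S : Type*} [TopologicalSpace S] [MeasurableSpace S]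
    (f : S →ᵇ ℝ) (μ : SignedMeasure S) : ℝ :=
  VectorMeasure.integral μ f (ContinuousLinearMap.lsmul ℝ ℝ).flip

/-- The weak topology on finite signed measures: the coarsest topology for which
`μ ↦ ∫ f dμ` is continuous for every bounded continuous `f`. -/
@[reducible] def weakMeasureTopology (S : Type*) [TopologicalSpace S] [MeasurableSpace S] :
    TopologicalSpace (SignedMeasure S) :=
  TopologicalSpace.induced (fun μ (f : S →ᵇ ℝ) => measurePairing f μ) inferInstance

/-- The Legendre transform `F^⋆(w) = sup_v (⟨v, w⟩ - F(v))` of an extended-real-valued function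
`F`, with respect to a pairing between `V` and `W`. -/
def legendreTransform {V W : Type*} (pairing : V → W → ℝ) (F : V → EReal) (w : W) : EReal :=
  ⨆ v, ((pairing v w : ℝ) : EReal) - F v

/-- Convexity of an extended-real-valued function: its epigraph is convex. -/
def EConvex {V : Type*} [AddCommGroup V] [Module ℝ V] (F : V → EReal) : Prop :=
  Convex ℝ {p : V × ℝ | F p.1 ≤ (p.2 : EReal)}

/-- `F` is Gateaux differentiable at `v` with Gateaux derivative the continuous linear
functional `L`. -/
def HasGateauxDerivAt {V : Type*} [NormedAddCommGroup V] [NormedSpace ℝ V]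
    (F : V → ℝ) (L : V →L[ℝ] ℝ) (v : V) : Prop :=
  ∀ w : V, HasLineDerivAt ℝ F (L w) v w

/-- The Monge–Ampère measure `MA_ν f = (∇ f^⋆)_# ν`, as a measure on `X`. -/
def mongeAmpere {n : ℕ} (X : Set (EuclideanSpace ℝ (Fin n)))
    (ν : Measure (EuclideanSpace ℝ (Fin n))) (f : X →ᵇ ℝ) : Measure X :=
  (ν.map (gradient (legendreOn X f))).comap Subtype.val

end

/-! ### The transform `f^⋆`, the functional `J_ν`, and near-optimal plans -/

section Legendre

variable {n : ℕ} {X : Set (EuclideanSpace ℝ (Fin n))}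

/-! If `X` lies in the ball of radius `R`, then `f^⋆` is a supremum of `R`-Lipschitz affine
functions bounded by `R‖y‖ + ‖f‖`, hence integrable. Pointwise in `y`, `f ↦ f^⋆(y)` is convex,
order-reversing and 1-Lipschitz in the sup norm, and `J_ν` inherits this.

Integrating `⟨x, y⟩ - f(x) ≤ f^⋆(y)` against a plan gives weak duality. A measurable choice of
`ε`-maximizers `T` makes `(T, id)_# ν` attain it up to `ε`, which yields the formula for `J_ν` as a
supremum over measures.

The converse formula is Kantorovich duality, proved as a minimax. Only the second marginal of `γ` is
fixed, and the first marginal condition is penalized by a Lagrangian in `g`. Separation in finite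
dimensions (`exists_weights_of_forall_exists_lt`) treats finitely many `g` at once; weak compactness
of the measures with second marginal `ν` treats all `g`; scaling `g` then forces the first marginal.
A signed measure with finite transform must be minus a probability measure. Convexity and lower
semicontinuity of `W22` follow, since it is now a supremum of affine weakly continuous functions.

Where `f^⋆` is differentiable the maximizing `x` is unique and equals `∇f^⋆(y)`. The envelope
argument gives the derivative `-g(∇f^⋆(y))`, and dominated convergence integrates it. -/

theorem exists_norm_le_of_isCompact (hX : IsCompact X) :
    ∃ R : NNReal, ∀ x ∈ X, ‖x‖ ≤ R := by
  obtain ⟨R, hR⟩ := hX.isBounded.exists_norm_le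
  exact ⟨R.toNNReal, fun x hx => (hR x hx).trans (Real.le_coe_toNNReal R)⟩

theorem abs_inner_le_of_norm_le {R : NNReal} (hR : ∀ x ∈ X, ‖x‖ ≤ R) (x : X)
    (y : EuclideanSpace ℝ (Fin n)) :
    |inner ℝ (x : EuclideanSpace ℝ (Fin n)) y| ≤ R * ‖y‖ :=
  (abs_real_inner_le_norm _ _).trans
    (mul_le_mul_of_nonneg_right (hR x x.2) (norm_nonneg y))

theorem bddAbove_range_inner_sub (hX : IsCompact X) (f : X →ᵇ ℝ)
    (y : EuclideanSpace ℝ (Fin n)) :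
    BddAbove (range fun x : X => inner ℝ (x : EuclideanSpace ℝ (Fin n)) y - f x) := by
  have := isCompact_iff_compactSpace.mp hX
  exact (isCompact_range (by fun_prop)).bddAbove

theorem inner_sub_le_legendreOn (hX : IsCompact X) (f : X →ᵇ ℝ)
    (y : EuclideanSpace ℝ (Fin n)) (x : X) :
    inner ℝ (x : EuclideanSpace ℝ (Fin n)) y - f x ≤ legendreOn X f y :=
  le_ciSup (bddAbove_range_inner_sub hX f y) x

theorem legendreOn_le (hne : X.Nonempty) {f : X → ℝ} {y : EuclideanSpace ℝ (Fin n)} {a : ℝ}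
    (h : ∀ x : X, inner ℝ (x : EuclideanSpace ℝ (Fin n)) y - f x ≤ a) :
    legendreOn X f y ≤ a :=
  have := hne.to_subtype
  ciSup_le h

theorem exists_legendreOn_eq (hX : IsCompact X) (hne : X.Nonempty) (f : X →ᵇ ℝ)
    (y : EuclideanSpace ℝ (Fin n)) :
    ∃ x : X, legendreOn X f y = inner ℝ (x : EuclideanSpace ℝ (Fin n)) y - f x := by
  have := isCompact_iff_compactSpace.mp hX
  have := hne.to_subtype
  have hc : Continuous fun x : X => inner ℝ (x : EuclideanSpace ℝ (Fin n)) y - f x := by fun_prop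
  obtain ⟨x, -, hx⟩ := isCompact_univ.exists_isMaxOn univ_nonempty hc.continuousOn
  exact ⟨x, le_antisymm (ciSup_le fun z => hx (mem_univ z)) (inner_sub_le_legendreOn hX f y x)⟩

theorem lipschitzWith_legendreOn (hX : IsCompact X) (hne : X.Nonempty) {R : NNReal}
    (hR : ∀ x ∈ X, ‖x‖ ≤ R) (f : X →ᵇ ℝ) : LipschitzWith R (legendreOn X f) := by
  refine LipschitzWith.of_le_add_mul R fun y z => legendreOn_le hne fun x => ?_
  have h1 := inner_sub_le_legendreOn hX f z x
  have h2 := (abs_le.mp (abs_inner_le_of_norm_le hR x (y - z))).2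
  rw [inner_sub_right] at h2
  rw [dist_eq_norm]
  linarith

theorem abs_legendreOn_le (hX : IsCompact X) (hne : X.Nonempty) {R : NNReal}
    (hR : ∀ x ∈ X, ‖x‖ ≤ R) (f : X →ᵇ ℝ) (y : EuclideanSpace ℝ (Fin n)) :
    |legendreOn X f y| ≤ R * ‖y‖ + ‖f‖ := by
  obtain ⟨x, hx⟩ := exists_legendreOn_eq hX hne f y
  have h1 := abs_le.mp (abs_inner_le_of_norm_le hR x y)
  have h2 := abs_le.mp (f.norm_coe_le_norm x)
  rw [hx, abs_le]
  constructor <;> linarith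

theorem integrable_legendreOn (hX : IsCompact X) (hne : X.Nonempty)
    {ν : Measure (EuclideanSpace ℝ (Fin n))} [IsFiniteMeasure ν]
    (hν : Integrable (fun y => ‖y‖) ν) (f : X →ᵇ ℝ) : Integrable (legendreOn X f) ν := by
  obtain ⟨R, hR⟩ := exists_norm_le_of_isCompact hX
  refine ((hν.const_mul (R : ℝ)).add (integrable_const ‖f‖)).mono'
    (lipschitzWith_legendreOn hX hne hR f).continuous.aestronglyMeasurable
    (.of_forall fun y => abs_legendreOn_le hX hne hR f y)

theorem legendreOn_le_add_norm_sub (hX : IsCompact X) (hne : X.Nonempty) (f g : X →ᵇ ℝ)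
    (y : EuclideanSpace ℝ (Fin n)) :
    legendreOn X f y ≤ legendreOn X g y + ‖f - g‖ :=
  legendreOn_le hne fun x => by
    have h1 := inner_sub_le_legendreOn hX g y x
    have h2 := (abs_le.mp ((f - g).norm_coe_le_norm x)).1
    rw [BoundedContinuousFunction.sub_apply] at h2
    linarith

theorem legendreOn_combo_le (hX : IsCompact X) (hne : X.Nonempty) (f g : X →ᵇ ℝ) {a b : ℝ}
    (ha : 0 ≤ a) (hb : 0 ≤ b) (hab : a + b = 1) (y : EuclideanSpace ℝ (Fin n)) :
    legendreOn X (a • f + b • g : X →ᵇ ℝ) y ≤ a * legendreOn X f y + b * legendreOn X g y :=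
  legendreOn_le hne fun x => by
    have h1 := mul_le_mul_of_nonneg_left (inner_sub_le_legendreOn hX f y x) ha
    have h2 := mul_le_mul_of_nonneg_left (inner_sub_le_legendreOn hX g y x) hb
    have h3 : inner ℝ (x : EuclideanSpace ℝ (Fin n)) y =
      a * inner ℝ (x : EuclideanSpace ℝ (Fin n)) y +
      b * inner ℝ (x : EuclideanSpace ℝ (Fin n)) y := by rw [← add_mul, hab, one_mul]
    simp only [BoundedContinuousFunction.add_apply, BoundedContinuousFunction.smul_apply,
      smul_eq_mul]
    linarith

/-- When `x` is a maximizer at `y`, the function `f^⋆ - ⟨x, ·⟩` has a global minimum at `y`, where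
its derivative must vanish. In particular the maximizer is unique. -/
theorem gradient_legendreOn_eq (hX : IsCompact X) (f : X →ᵇ ℝ)
    {y : EuclideanSpace ℝ (Fin n)} (hd : DifferentiableAt ℝ (legendreOn X f) y) {x : X}
    (hx : legendreOn X f y = inner ℝ (x : EuclideanSpace ℝ (Fin n)) y - f x) :
    gradient (legendreOn X f) y = x := by
  have h1 : HasFDerivAt
      (fun z => legendreOn X f z - inner ℝ (x : EuclideanSpace ℝ (Fin n)) z)
      (fderiv ℝ (legendreOn X f) y - innerSL ℝ (x : EuclideanSpace ℝ (Fin n))) y :=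
    hd.hasFDerivAt.sub (innerSL ℝ (x : EuclideanSpace ℝ (Fin n))).hasFDerivAt
  have h2 : IsLocalMin
      (fun z => legendreOn X f z - inner ℝ (x : EuclideanSpace ℝ (Fin n)) z) y :=
    .of_forall fun z => by
      have := inner_sub_le_legendreOn hX f z x
      simp only [hx]
      linarith
  have h3 := sub_eq_zero.mp (h2.hasFDerivAt_eq_zero h1)
  rw [gradient, h3]
  exact (InnerProductSpace.toDual ℝ _).symm_apply_apply _

variable {ν : Measure (EuclideanSpace ℝ (Fin n))}

theorem continuous_innerCost : Continuous (innerCost X) := by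
  unfold innerCost
  fun_prop

theorem integrable_innerCost (hX : IsCompact X) (hν : Integrable (fun y => ‖y‖) ν)
    {γ : Measure (X × EuclideanSpace ℝ (Fin n))} (hγ : γ.map Prod.snd = ν) :
    Integrable (innerCost X) γ := by
  obtain ⟨R, hR⟩ := exists_norm_le_of_isCompact hX
  rw [← hγ] at hν
  refine ((hν.comp_measurable measurable_snd).const_mul (R : ℝ)).mono'
    (continuous_innerCost.measurable.aestronglyMeasurable) (.of_forall fun p => ?_)
  rw [Real.norm_eq_abs, innerCost, abs_neg]
  exact abs_inner_le_of_norm_le hR p.1 p.2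

variable [IsProbabilityMeasure ν]

theorem JFunctional_le_add_norm_sub (hX : IsCompact X) (hne : X.Nonempty)
    (hν : Integrable (fun y => ‖y‖) ν) (f g : X →ᵇ ℝ) :
    JFunctional X ν f ≤ JFunctional X ν g + ‖f - g‖ := by
  have h := integral_mono (integrable_legendreOn hX hne hν f)
    ((integrable_legendreOn hX hne hν g).add (integrable_const ‖f - g‖))
    (fun y => legendreOn_le_add_norm_sub hX hne f g y)
  rw [integral_add' (integrable_legendreOn hX hne hν g) (integrable_const _)] at h
  simpa [JFunctional] using h

theorem lipschitzWith_JFunctional (hX : IsCompact X) (hne : X.Nonempty)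
    (hν : Integrable (fun y => ‖y‖) ν) : LipschitzWith 1 (JFunctional X ν) :=
  LipschitzWith.of_le_add fun f g => by
    rw [dist_eq_norm]
    exact JFunctional_le_add_norm_sub hX hne hν f g

theorem convexOn_JFunctional (hX : IsCompact X) (hne : X.Nonempty)
    (hν : Integrable (fun y => ‖y‖) ν) : ConvexOn ℝ univ (JFunctional X ν) := by
  refine ⟨convex_univ, fun f _ g _ a b ha hb hab => ?_⟩
  have hf := integrable_legendreOn hX hne hν f
  have hg := integrable_legendreOn hX hne hν g
  have h := integral_mono (integrable_legendreOn hX hne hν (a • f + b • g))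
    ((hf.const_mul a).add (hg.const_mul b))
    (fun y => legendreOn_combo_le hX hne f g ha hb hab y)
  rw [integral_add' (hf.const_mul a) (hg.const_mul b), integral_const_mul,
    integral_const_mul] at h
  exact h

theorem JFunctional_anti (hX : IsCompact X) (hne : X.Nonempty)
    (hν : Integrable (fun y => ‖y‖) ν) {f g : X →ᵇ ℝ} (hfg : ∀ x, f x ≤ g x) :
    JFunctional X ν g ≤ JFunctional X ν f :=
  integral_mono (integrable_legendreOn hX hne hν g) (integrable_legendreOn hX hne hν f)
    fun y => legendreOn_le hne fun x =>
      (sub_le_sub_left (hfg x) _).trans (inner_sub_le_legendreOn hX f y x)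

theorem JFunctional_const_le (hX : IsCompact X) (hne : X.Nonempty)
    (hν : Integrable (fun y => ‖y‖) ν) (c : ℝ) :
    JFunctional X ν (BoundedContinuousFunction.const X c) ≤ JFunctional X ν 0 - c := by
  have h := integral_mono
    (integrable_legendreOn hX hne hν (BoundedContinuousFunction.const X c))
    ((integrable_legendreOn hX hne hν 0).sub (integrable_const c))
    (fun y => legendreOn_le hne fun x => by
      have := inner_sub_le_legendreOn hX 0 y x
      have h0 : (0 : X →ᵇ ℝ) x = 0 := rfl
      simp only [Pi.sub_apply, BoundedContinuousFunction.const_apply]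
      linarith)
  rw [integral_sub' (integrable_legendreOn hX hne hν 0) (integrable_const _)] at h
  simpa [JFunctional] using h

/-- Weak duality: `⟨x, y⟩ - f(x) ≤ f^⋆(y)` integrated against the plan. -/
theorem neg_integral_innerCost_sub_le (hX : IsCompact X) (hne : X.Nonempty)
    (hν : Integrable (fun y => ‖y‖) ν) (f : X →ᵇ ℝ) {m : Measure X} [IsFiniteMeasure m]
    {γ : Measure (X × EuclideanSpace ℝ (Fin n))} (hγ : γ ∈ transportPlans m ν) :
    -∫ x, f x ∂m - ∫ p, innerCost X p ∂γ ≤ JFunctional X ν f := by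
  obtain ⟨hp, h1, h2⟩ := hγ
  have hc := integrable_innerCost hX hν h2
  have hf : Integrable (fun p : X × EuclideanSpace ℝ (Fin n) => f p.1) γ :=
    (f.integrable (γ.map Prod.fst)).comp_measurable measurable_fst
  have hf' : Integrable (fun p : X × EuclideanSpace ℝ (Fin n) => -f p.1) γ := hf.neg
  have hJ := integrable_legendreOn hX hne hν f
  have e1 : ∫ x, f x ∂m = ∫ p, f p.1 ∂γ := by
    rw [← h1, integral_map measurable_fst.aemeasurable f.continuous.aestronglyMeasurable]
  have e2 : JFunctional X ν f = ∫ p, legendreOn X f p.2 ∂γ := by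
    rw [JFunctional, ← h2, integral_map measurable_snd.aemeasurable (by rw [h2]; exact hJ.1)]
  rw [e1, e2, ← integral_neg, ← integral_sub hf' hc]
  refine integral_mono (hf'.sub hc) ?_ fun p => ?_
  · rw [← h2] at hJ
    exact hJ.comp_measurable measurable_snd
  · have := inner_sub_le_legendreOn hX f p.2 p.1
    simp only [innerCost]
    linarith

/-- The first `ε`-optimal term of a dense sequence depends measurably on `y`; allowing the error `ε`
avoids any selection theorem. -/
theorem exists_measurable_almost_maximizer (hX : IsCompact X) (hne : X.Nonempty) (f : X →ᵇ ℝ)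
    {ε : ℝ} (hε : 0 < ε) :
    ∃ T : EuclideanSpace ℝ (Fin n) → X, Measurable T ∧
      ∀ y, legendreOn X f y - ε < inner ℝ (T y : EuclideanSpace ℝ (Fin n)) y - f (T y) := by
  classical
  have := hne.to_subtype
  obtain ⟨R, hR⟩ := exists_norm_le_of_isCompact hX
  let u := TopologicalSpace.denseSeq X
  have hc := (lipschitzWith_legendreOn hX hne hR f).continuous
  have hex : ∀ y, ∃ k, legendreOn X f y - ε <
      inner ℝ (u k : EuclideanSpace ℝ (Fin n)) y - f (u k) := by
    intro y
    obtain ⟨x, hx⟩ := exists_legendreOn_eq hX hne f y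
    have ho : IsOpen {x : X | legendreOn X f y - ε <
        inner ℝ (x : EuclideanSpace ℝ (Fin n)) y - f x} :=
      isOpen_lt (by fun_prop) (by fun_prop)
    exact (TopologicalSpace.denseRange_denseSeq X).exists_mem_open ho
      ⟨x, by simp only [mem_ofPred_eq, hx]; linarith⟩
  refine ⟨fun y => u (Nat.find (hex y)), (measurable_from_nat (f := u)).comp
    (measurable_find hex fun k => measurableSet_lt ?_ ?_), fun y => Nat.find_spec (hex y)⟩
  · exact (hc.sub continuous_const).measurable
  · exact Continuous.measurable (by fun_prop)

theorem exists_transportPlan_lt (hX : IsCompact X) (hne : X.Nonempty)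
    (hν : Integrable (fun y => ‖y‖) ν) (f : X →ᵇ ℝ) {ε : ℝ} (hε : 0 < ε) :
    ∃ (m : ProbabilityMeasure X) (γ : Measure (X × EuclideanSpace ℝ (Fin n))),
      γ ∈ transportPlans (m : Measure X) ν ∧
      JFunctional X ν f - ε ≤ -∫ x, f x ∂(m : Measure X) - ∫ p, innerCost X p ∂γ := by
  obtain ⟨T, hT, hTy⟩ := exists_measurable_almost_maximizer hX hne f hε
  have hTid : Measurable fun y => (T y, y) := hT.prodMk measurable_id
  have h2 : (ν.map fun y => (T y, y)).map Prod.snd = ν := by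
    rw [Measure.map_map measurable_snd hTid]
    exact Measure.map_id
  have hc := integrable_innerCost hX hν h2
  refine ⟨⟨ν.map T, Measure.isProbabilityMeasure_map hT.aemeasurable⟩, ν.map fun y => (T y, y),
    ⟨Measure.isProbabilityMeasure_map hTid.aemeasurable, ?_, h2⟩, ?_⟩
  · rw [Measure.map_map measurable_fst hTid]
    rfl
  · have hf : Integrable (fun y => f (T y)) ν :=
      (f.integrable (ν.map T)).comp_measurable hT
    have hf' : Integrable (fun y => -f (T y)) ν := hf.neg
    have hc' : Integrable (fun y => innerCost X (T y, y)) ν := hc.comp_measurable hTid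
    have hJ := integrable_legendreOn hX hne hν f
    rw [ProbabilityMeasure.coe_mk, integral_map hT.aemeasurable f.continuous.aestronglyMeasurable,
      integral_map hTid.aemeasurable continuous_innerCost.measurable.aestronglyMeasurable,
      ← integral_neg, ← integral_sub hf' hc']
    have h := integral_mono (hJ.sub (integrable_const ε)) (hf'.sub hc')
      fun y => by
        have := (hTy y).le
        simp only [Pi.sub_apply, innerCost]
        linarith
    rw [integral_sub' hJ (integrable_const ε)] at h
    simpa [JFunctional] using h

end Legendre

/-! ### Signed measures tested against bounded continuous functions -/

section Pairing

variable {S : Type*} [TopologicalSpace S] [MeasurableSpace S]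

/-- Indicators of closed sets are limits of continuous functions, and inner regularity passes from
closed sets to all measurable ones. -/
theorem measure_le_of_forall_integral_le [TopologicalSpace.PseudoMetrizableSpace S] [BorelSpace S]
    {p q : Measure S} [IsFiniteMeasure p] [IsFiniteMeasure q]
    (h : ∀ g : S →ᵇ ℝ, 0 ≤ g → ∫ x, g x ∂p ≤ ∫ x, g x ∂q) : p ≤ q := by
  have hcl : ∀ F : Set S, IsClosed F → p F ≤ q F := by
    intro F hF
    refine le_of_tendsto_of_tendsto' (HasOuterApproxClosed.tendsto_lintegral_apprSeq hF p)
      (HasOuterApproxClosed.tendsto_lintegral_apprSeq hF q) fun k => ?_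
    let u : S →ᵇ ℝ := BoundedContinuousFunction.comp ((↑) : NNReal → ℝ) (LipschitzWith.subtype_val _)
      (hF.apprSeq k)
    have hu : ∀ x, ((hF.apprSeq k x : NNReal) : ENNReal) = ENNReal.ofReal (u x) := fun x =>
      (ENNReal.ofReal_coe_nnreal).symm
    have hu0 : 0 ≤ u := fun x => NNReal.coe_nonneg _
    simp_rw [hu]
    rw [← ofReal_integral_eq_lintegral_ofReal (u.integrable p) (.of_forall hu0),
      ← ofReal_integral_eq_lintegral_ofReal (u.integrable q) (.of_forall hu0)]
    exact ENNReal.ofReal_le_ofReal (h u hu0)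
  refine Measure.le_iff.mpr fun A hA => ?_
  rw [hA.measure_eq_iSup_isClosed_of_ne_top (measure_ne_top p A)]
  exact iSup₂_le fun F hFA => iSup_le fun hF => (hcl F hF).trans (measure_mono hFA)

instance isFiniteMeasure_variation_signedMeasure {S : Type*} [MeasurableSpace S]
    (μ : SignedMeasure S) : IsFiniteMeasure μ.variation := by
  rw [← SignedMeasure.totalVariation_eq_variation]
  infer_instance

theorem integrable_variation [OpensMeasurableSpace S] (f : S →ᵇ ℝ) (μ : SignedMeasure S) : μ.Integrable f :=
  f.integrable _

theorem measurePairing_toSignedMeasure (f : S →ᵇ ℝ) (m : Measure S) [IsFiniteMeasure m] :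
    measurePairing f m.toSignedMeasure = ∫ x, f x ∂m :=
  VectorMeasure.integral_toSignedMeasure

theorem measurePairing_neg (f : S →ᵇ ℝ) (μ : SignedMeasure S) :
    measurePairing f (-μ) = -measurePairing f μ :=
  VectorMeasure.integral_neg_vectorMeasure

theorem measurePairing_add [OpensMeasurableSpace S] (f : S →ᵇ ℝ) (μ ρ : SignedMeasure S) :
    measurePairing f (μ + ρ) = measurePairing f μ + measurePairing f ρ :=
  VectorMeasure.integral_add_vectorMeasure (integrable_variation f μ) (integrable_variation f ρ)

theorem measurePairing_sub [OpensMeasurableSpace S] (f : S →ᵇ ℝ) (μ ρ : SignedMeasure S) :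
    measurePairing f (μ - ρ) = measurePairing f μ - measurePairing f ρ :=
  VectorMeasure.integral_sub_vectorMeasure (integrable_variation f μ) (integrable_variation f ρ)

theorem measurePairing_smul (f : S →ᵇ ℝ) (c : ℝ) (μ : SignedMeasure S) :
    measurePairing f (c • μ) = c * measurePairing f μ :=
  VectorMeasure.integral_smul_vectorMeasure f c

theorem smul_measurePairing (c : ℝ) (f : S →ᵇ ℝ) (μ : SignedMeasure S) :
    measurePairing (c • f) μ = c * measurePairing f μ :=
  VectorMeasure.integral_smul f _ _ c

theorem const_measurePairing (c : ℝ) (μ : SignedMeasure S) :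
    measurePairing (BoundedContinuousFunction.const S c) μ = c * μ univ := by
  have : measurePairing (BoundedContinuousFunction.const S c) μ =
      (ContinuousLinearMap.lsmul ℝ ℝ).flip c (μ univ) := VectorMeasure.integral_const c
  rw [this]
  simp [mul_comm]

/-- The sign condition gives positive part ≤ negative part in the Jordan decomposition. As the two
are mutually singular, the positive part is singular to itself, hence zero. -/
theorem exists_eq_neg_toSignedMeasure {S : Type*} [TopologicalSpace S] [MeasurableSpace S]
    [TopologicalSpace.PseudoMetrizableSpace S] [BorelSpace S] {μ : SignedMeasure S}
    (h : ∀ g : S →ᵇ ℝ, 0 ≤ g → measurePairing g μ ≤ 0) :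
    ∃ q : Measure S, ∃ _ : IsFiniteMeasure q, -μ = q.toSignedMeasure := by
  set j := μ.toJordanDecomposition
  have hμ : μ = j.posPart.toSignedMeasure - j.negPart.toSignedMeasure :=
    μ.toSignedMeasure_toJordanDecomposition.symm
  have hle : j.posPart ≤ j.negPart := measure_le_of_forall_integral_le fun g hg => by
    have := h g hg
    rw [hμ, measurePairing_sub, measurePairing_toSignedMeasure,
      measurePairing_toSignedMeasure] at this
    linarith
  have h0 : j.posPart = 0 := by
    rw [← Measure.MutuallySingular.self_iff]
    exact j.mutuallySingular.mono_ac Measure.AbsolutelyContinuous.rfl hle.absolutelyContinuous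
  refine ⟨j.negPart, inferInstance, ?_⟩
  rw [hμ, neg_sub]
  simp [h0]

end Pairing

/-! ### Existence of good plans: compactness and minimax -/

section Kantorovich

open Filter Topology

variable {n : ℕ} {X : Set (EuclideanSpace ℝ (Fin n))}
  {ν : Measure (EuclideanSpace ℝ (Fin n))}

/-- Prokhorov: both families of marginals are tight, the first because `X` is compact, the second
because it lies in `{ν}`. -/
theorem isCompact_setOf_map_snd_eq (hX : IsCompact X) [IsProbabilityMeasure ν] :
    IsCompact {γ : ProbabilityMeasure (X × EuclideanSpace ℝ (Fin n)) |
      (γ : Measure (X × EuclideanSpace ℝ (Fin n))).map Prod.snd = ν} := by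
  have := isCompact_iff_compactSpace.mp hX
  set K := {γ : ProbabilityMeasure (X × EuclideanSpace ℝ (Fin n)) |
      (γ : Measure (X × EuclideanSpace ℝ (Fin n))).map Prod.snd = ν} with hK
  have hcl : IsClosed K := by
    let ν' : ProbabilityMeasure (EuclideanSpace ℝ (Fin n)) := ⟨ν, inferInstance⟩
    have h : K = (fun γ : ProbabilityMeasure (X × EuclideanSpace ℝ (Fin n)) =>
        γ.map continuous_snd.measurable.aemeasurable) ⁻¹' {ν'} := by
      ext γ
      rw [mem_preimage, mem_singleton_iff, ← ProbabilityMeasure.toMeasure_injective.eq_iff]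
      exact Iff.rfl
    rw [h]
    exact isClosed_singleton.preimage (ProbabilityMeasure.continuous_map continuous_snd)
  rw [← hcl.closure_eq]
  refine isCompact_closure_of_isTightMeasureSet (IsTightMeasureSet.prodMk ?_ ?_)
  · exact IsTightMeasureSet.of_compactSpace
  · refine (isTightMeasureSet_singleton (μ := ν)).subset ?_
    rintro _ ⟨_, ⟨γ, hγ, rfl⟩, rfl⟩
    exact hγ

/-- The shifted cost `R‖y‖ - ⟨x, y⟩` truncated to the interval `[0, N]`. -/
noncomputable def truncatedCost (X : Set (EuclideanSpace ℝ (Fin n))) (R : NNReal) (N : ℕ) :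
    X × EuclideanSpace ℝ (Fin n) →ᵇ ℝ :=
  BoundedContinuousFunction.ofNormedAddCommGroup
    (fun p => max 0 (min (innerCost X p + R * ‖p.2‖) N))
    (by have := continuous_innerCost (X := X); fun_prop) N
    (fun p => by
      rw [Real.norm_of_nonneg (le_max_left _ _)]
      exact max_le N.cast_nonneg (min_le_right _ _))

theorem innerCost_add_nonneg {R : NNReal} (hR : ∀ x ∈ X, ‖x‖ ≤ R)
    (p : X × EuclideanSpace ℝ (Fin n)) : 0 ≤ innerCost X p + R * ‖p.2‖ := by
  have := (abs_le.mp (abs_inner_le_of_norm_le hR p.1 p.2)).2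
  rw [innerCost]
  linarith

/-- The cost is unbounded, so its integral need not be weakly continuous in `γ`. The nonnegative
shifted cost is the limit of its truncations, which exhibits a sublevel condition as an intersection
of weakly closed ones. -/
theorem forall_integral_truncatedCost_le_iff (hX : IsCompact X) {R : NNReal}
    (hR : ∀ x ∈ X, ‖x‖ ≤ R) (hν : Integrable (fun y => ‖y‖) ν)
    {γ : Measure (X × EuclideanSpace ℝ (Fin n))} [IsFiniteMeasure γ]
    (hγ : γ.map Prod.snd = ν) (a : ℝ) :
    (∀ N : ℕ, ∫ p, truncatedCost X R N p ∂γ ≤ a) ↔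
      ∫ p, innerCost X p ∂γ + R * ∫ y, ‖y‖ ∂ν ≤ a := by
  have hc := integrable_innerCost hX hν hγ
  have hy : Integrable (fun p : X × EuclideanSpace ℝ (Fin n) => R * ‖p.2‖) γ := by
    rw [← hγ] at hν
    exact (hν.comp_measurable measurable_snd).const_mul _
  have e : ∫ p, innerCost X p ∂γ + R * ∫ y, ‖y‖ ∂ν =
      ∫ p, (innerCost X p + R * ‖p.2‖) ∂γ := by
    rw [integral_add hc hy, integral_const_mul, ← hγ,
      integral_map measurable_snd.aemeasurable continuous_norm.aestronglyMeasurable]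
  have hle : ∀ N p, truncatedCost X R N p ≤ innerCost X p + R * ‖p.2‖ := fun N p =>
    max_le (innerCost_add_nonneg hR p) (min_le_left _ _)
  rw [e]
  refine ⟨fun h => ?_, fun h N => (integral_mono ((truncatedCost X R N).integrable γ)
    (hc.add hy) (hle N)).trans h⟩
  refine le_of_tendsto' (tendsto_integral_of_dominated_convergence
    (fun p => innerCost X p + R * ‖p.2‖)
    (fun N => ((truncatedCost X R N).integrable γ).aestronglyMeasurable) (hc.add hy)
    (fun N => .of_forall fun p => ?_) (.of_forall fun p => ?_)) h
  · rw [Real.norm_of_nonneg (show 0 ≤ truncatedCost X R N p from le_max_left _ _)]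
    exact hle N p
  · refine tendsto_const_nhds.congr' ?_
    filter_upwards [eventually_ge_atTop ⌈innerCost X p + R * ‖p.2‖⌉₊] with N hN
    have h1 : min (innerCost X p + R * ‖p.2‖) (N : ℝ) = innerCost X p + R * ‖p.2‖ :=
      min_eq_left (Nat.ceil_le.mp hN)
    change _ = max 0 (min (innerCost X p + R * ‖p.2‖) (N : ℝ))
    rw [h1, max_eq_right (innerCost_add_nonneg hR p)]

/-- A finite minimax: `t` misses the open orthant of vectors with all coordinates below `b`, and a
separating functional, once normalized, provides the weights. -/
theorem exists_weights_of_forall_exists_lt {ι : Type*} [Finite ι] {t : Set (ι → ℝ)}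
    (ht : Convex ℝ t) (hne : t.Nonempty) {b : ℝ} (h : ∀ v ∈ t, ∃ i, b ≤ v i) :
    ∃ w : ι → ℝ, (∀ i, 0 ≤ w i) ∧ ∑ᶠ i, w i = 1 ∧ ∀ v ∈ t, b ≤ ∑ᶠ i, w i * v i := by
  classical
  have := Fintype.ofFinite ι
  simp only [finsum_eq_sum_of_fintype]
  have hopen : IsOpen (univ.pi fun _ : ι => Iio b) :=
    isOpen_set_pi finite_univ fun _ _ => isOpen_Iio
  have hdisj : Disjoint (univ.pi fun _ : ι => Iio b) t := by
    rw [Set.disjoint_left]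
    intro v hv hvt
    obtain ⟨i, hi⟩ := h v hvt
    exact absurd (hv i (mem_univ i)) (not_lt.mpr hi)
  obtain ⟨f, α, hs, hft⟩ := geometric_hahn_banach_open
    (convex_pi fun _ _ => convex_Iio b) hopen ht hdisj
  set w : ι → ℝ := fun i => f (Pi.single i 1) with hw
  have hf : ∀ v, f v = ∑ i, w i * v i := fun v => by
    conv_lhs => rw [← Finset.univ_sum_single v, map_sum]
    refine Finset.sum_congr rfl fun i _ => ?_
    rw [hw, ← mul_one (v i), ← smul_eq_mul (v i), Pi.single_smul, map_smul]
    simp [mul_comm]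
  have hw0 : ∀ i, 0 ≤ w i := by
    intro i
    by_contra! hi
    set v : ι → ℝ := fun _ => b - 1
    -- Decreasing coordinate `i` stays in the orthant, but with `w i < 0` it would push `f` past
    -- `α`.
    have hr : ∀ r : ℝ, 0 ≤ r → f v - r * w i < α := fun r hr => by
      have := hs (v - r • Pi.single i 1) fun j _ => by
        have : 0 ≤ r * (Pi.single i 1 : ι → ℝ) j :=
          mul_nonneg hr (by by_cases hj : j = i <;> simp [hj])
        simp only [Pi.sub_apply, Pi.smul_apply, smul_eq_mul, mem_Iio, v]
        linarith
      rwa [map_sub, map_smul, smul_eq_mul] at this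
    have h1 := hr ((|α - f v|) / (-w i)) (div_nonneg (abs_nonneg _) (by linarith))
    have h2 : |α - f v| / (-w i) * w i = -|α - f v| := by
      rw [div_neg, neg_mul, div_mul_cancel₀ _ hi.ne]
    have := le_abs_self (α - f v)
    rw [h2] at h1
    linarith
  have hsum : ∀ ε > 0, (b - ε) * ∑ i, w i < α := fun ε hε => by
    have := hs (fun _ => b - ε) fun _ _ => by simp only [mem_Iio]; linarith
    rwa [hf, ← Finset.sum_mul, mul_comm] at this
  have hW0 : 0 ≤ ∑ i, w i := Finset.sum_nonneg fun i _ => hw0 i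
  have hW : 0 < ∑ i, w i := by
    -- If all weights vanished, separation would read `0 < α` on the orthant and `α ≤ 0` on the
    -- nonempty `t`.
    refine hW0.lt_of_ne' fun h0 => ?_
    have hz := (Finset.sum_eq_zero_iff_of_nonneg fun i _ => hw0 i).mp h0
    obtain ⟨v, hv⟩ := hne
    have h1 := hft v hv
    have h2 := hsum 1 one_pos
    rw [hf, Finset.sum_eq_zero fun i hi => by rw [hz i hi, zero_mul]] at h1
    rw [h0, mul_zero] at h2
    linarith
  have hb : b * ∑ i, w i ≤ α := by
    refine le_of_forall_pos_lt_add fun ε hε => ?_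
    have := hsum (ε / ∑ i, w i) (div_pos hε hW)
    rw [sub_mul, div_mul_cancel₀ _ hW.ne'] at this
    linarith
  refine ⟨fun i => w i / ∑ i, w i, fun i => div_nonneg (hw0 i) hW0, ?_, fun v hv => ?_⟩
  · rw [← Finset.sum_div, div_self hW.ne']
  · simp_rw [div_mul_eq_mul_div]
    rw [← Finset.sum_div, le_div_iff₀ hW, ← hf]
    exact hb.trans (hft v hv)

/-- The Lagrangian `∫ c dγ + ∫ g dγ₁ - ∫ g dm` of the transport problem from `m`, where `γ₁` is
the first marginal of `γ`. -/
noncomputable def transportLagrangian (m : Measure X)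
    (γ : Measure (X × EuclideanSpace ℝ (Fin n))) (g : X →ᵇ ℝ) : ℝ :=
  ∫ p, innerCost X p ∂γ + ∫ p, g p.1 ∂γ - ∫ x, g x ∂m

theorem integrable_comp_fst (γ : Measure (X × EuclideanSpace ℝ (Fin n))) [IsFiniteMeasure γ]
    (g : X →ᵇ ℝ) : Integrable (fun p => g p.1) γ :=
  (g.integrable (γ.map Prod.fst)).comp_measurable measurable_fst

theorem transportLagrangian_smul (m : Measure X)
    (γ : Measure (X × EuclideanSpace ℝ (Fin n))) (c : ℝ) (g : X →ᵇ ℝ) :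
    transportLagrangian m γ (c • g) =
      ∫ p, innerCost X p ∂γ + c * (∫ p, g p.1 ∂γ - ∫ x, g x ∂m) := by
  simp only [transportLagrangian, BoundedContinuousFunction.smul_apply, smul_eq_mul,
    integral_const_mul]
  ring

theorem transportLagrangian_sum {ι : Type*} [Fintype ι] (m : Measure X) [IsFiniteMeasure m]
    (γ : Measure (X × EuclideanSpace ℝ (Fin n))) [IsFiniteMeasure γ]
    (w : ι → ℝ) (hw : ∑ i, w i = 1) (g : ι → X →ᵇ ℝ) :
    transportLagrangian m γ (∑ i, w i • g i) = ∑ i, w i * transportLagrangian m γ (g i) := by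
  simp only [transportLagrangian, mul_sub, mul_add, Finset.sum_add_distrib,
    Finset.sum_sub_distrib, ← Finset.sum_mul, hw, one_mul,
    BoundedContinuousFunction.coe_sum, Finset.sum_apply, BoundedContinuousFunction.smul_apply,
    smul_eq_mul]
  rw [integral_finsetSum _ fun i _ => (integrable_comp_fst γ (g i)).const_mul _,
    integral_finsetSum _ fun i _ => ((g i).integrable m).const_mul _]
  simp only [integral_const_mul]

theorem transportLagrangian_combo (hX : IsCompact X) (hν : Integrable (fun y => ‖y‖) ν)
    (m : Measure X) {γ₁ γ₂ : Measure (X × EuclideanSpace ℝ (Fin n))}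
    [IsFiniteMeasure γ₁] [IsFiniteMeasure γ₂]
    (h₁ : γ₁.map Prod.snd = ν) (h₂ : γ₂.map Prod.snd = ν) {a b : NNReal} (hab : a + b = 1)
    (g : X →ᵇ ℝ) :
    transportLagrangian m (a • γ₁ + b • γ₂) g =
      a * transportLagrangian m γ₁ g + b * transportLagrangian m γ₂ g := by
  have hab' : (a : ℝ) + b = 1 := by exact_mod_cast hab
  rw [transportLagrangian,
    integral_add_measure ((integrable_innerCost hX hν h₁).smul_measure_nnreal)
      ((integrable_innerCost hX hν h₂).smul_measure_nnreal),
    integral_add_measure ((integrable_comp_fst γ₁ g).smul_measure_nnreal)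
      ((integrable_comp_fst γ₂ g).smul_measure_nnreal)]
  simp only [integral_smul_nnreal_measure, transportLagrangian, NNReal.smul_def, smul_eq_mul]
  linear_combination (∫ x, g x ∂m) * hab'

/-- For a single `g` a near-optimal plan works. If no `γ` served all of `u`, the finite minimax
would give a convex combination of the `g` for which no `γ` works. -/
theorem exists_transportLagrangian_le (hX : IsCompact X) (hne : X.Nonempty)
    [IsProbabilityMeasure ν] (hν : Integrable (fun y => ‖y‖) ν) (m : Measure X)
    [IsFiniteMeasure m] {a b : ℝ} (hab : a < b)
    (ha : ∀ g : X →ᵇ ℝ, -∫ x, g x ∂m - JFunctional X ν g ≤ a) (u : Finset (X →ᵇ ℝ)) :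
    ∃ γ : ProbabilityMeasure (X × EuclideanSpace ℝ (Fin n)),
      (γ : Measure (X × EuclideanSpace ℝ (Fin n))).map Prod.snd = ν ∧
      ∀ g ∈ u, transportLagrangian m γ g ≤ b := by
  have hlt : ∀ g : X →ᵇ ℝ, ∃ γ : ProbabilityMeasure (X × EuclideanSpace ℝ (Fin n)),
      (γ : Measure (X × EuclideanSpace ℝ (Fin n))).map Prod.snd = ν ∧
      transportLagrangian m γ g < b := by
    intro g
    obtain ⟨m', γ, ⟨hp, h1, h2⟩, hJ⟩ := exists_transportPlan_lt hX hne hν g (half_pos (sub_pos.mpr hab))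
    refine ⟨⟨γ, hp⟩, h2, ?_⟩
    have e : ∫ x, g x ∂(m' : Measure X) = ∫ p, g p.1 ∂γ := by
      rw [← h1, integral_map measurable_fst.aemeasurable g.continuous.aestronglyMeasurable]
    have := ha g
    simp only [transportLagrangian, ProbabilityMeasure.coe_mk]
    linarith
  by_contra! hcon
  let t : Set (u → ℝ) := {v | ∃ γ : ProbabilityMeasure (X × EuclideanSpace ℝ (Fin n)),
    (γ : Measure (X × EuclideanSpace ℝ (Fin n))).map Prod.snd = ν ∧
      v = fun g : u => transportLagrangian m γ g}
  have htc : Convex ℝ t := by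
    rintro _ ⟨γ₁, h₁, rfl⟩ _ ⟨γ₂, h₂, rfl⟩ a b ha hb hab
    lift a to NNReal using ha
    lift b to NNReal using hb
    have hab' : a + b = 1 := by exact_mod_cast hab
    have hsnd : ((a • (γ₁ : Measure (X × EuclideanSpace ℝ (Fin n))) +
        b • (γ₂ : Measure (X × EuclideanSpace ℝ (Fin n)))).map Prod.snd) = ν := by
      rw [Measure.map_add _ _ measurable_snd, Measure.map_smul, Measure.map_smul, h₁, h₂,
        ← add_smul, hab', one_smul]
    refine ⟨⟨a • (γ₁ : Measure (X × EuclideanSpace ℝ (Fin n))) + b • γ₂, ?_⟩, hsnd, ?_⟩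
    · exact ⟨by
        have := measure_univ (μ := ν)
        rw [← hsnd, Measure.map_apply measurable_snd .univ] at this
        simpa using this⟩
    · ext g
      exact (transportLagrangian_combo hX hν m h₁ h₂ hab' g).symm
  obtain ⟨γ₀, h₀, -⟩ := hlt 0
  obtain ⟨w, hw0, hw1, hw⟩ := exists_weights_of_forall_exists_lt htc ⟨_, γ₀, h₀, rfl⟩ (b := b) (by
    rintro _ ⟨γ, hγ, rfl⟩
    obtain ⟨g, hg, hgb⟩ := hcon γ hγ
    exact ⟨⟨g, hg⟩, hgb.le⟩)
  simp only [finsum_eq_sum_of_fintype] at hw1 hw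
  -- The Lagrangian is affine in `g` and the weights sum to one, so its value at the averaged `g` is
  -- the weighted average, which is at least `b`.
  obtain ⟨γ, hγ, hγb⟩ := hlt (∑ i, w i • (i : X →ᵇ ℝ))
  have := hw _ ⟨γ, hγ, rfl⟩
  rw [transportLagrangian_sum m γ w hw1] at hγb
  linarith

theorem exists_transportPlan_integral_le (hX : IsCompact X) (hne : X.Nonempty)
    [IsProbabilityMeasure ν] (hν : Integrable (fun y => ‖y‖) ν) (m : Measure X)
    [IsFiniteMeasure m] {a b : ℝ} (hab : a < b)
    (ha : ∀ g : X →ᵇ ℝ, -∫ x, g x ∂m - JFunctional X ν g ≤ a) :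
    ∃ γ ∈ transportPlans m ν, ∫ p, innerCost X p ∂γ ≤ b := by
  obtain ⟨R, hR⟩ := exists_norm_le_of_isCompact hX
  -- On measures with second marginal `ν`, membership in `D g` says that the Lagrangian at `g` is at
  -- most `b`; written with truncated costs, the condition is visibly closed.
  let D : (X →ᵇ ℝ) → Set (ProbabilityMeasure (X × EuclideanSpace ℝ (Fin n))) := fun g =>
    ⋂ N : ℕ, {γ | ∫ p, truncatedCost X R N p ∂(γ : Measure (X × EuclideanSpace ℝ (Fin n))) ≤
      b + R * ∫ y, ‖y‖ ∂ν + ∫ x, g x ∂m -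
        ∫ p, g p.1 ∂(γ : Measure (X × EuclideanSpace ℝ (Fin n)))}
  have hD : ∀ g (γ : ProbabilityMeasure (X × EuclideanSpace ℝ (Fin n))),
      (γ : Measure (X × EuclideanSpace ℝ (Fin n))).map Prod.snd = ν →
      (γ ∈ D g ↔ transportLagrangian m γ g ≤ b) := fun g γ hγ => by
    simp only [D, mem_iInter, mem_ofPred_eq, forall_integral_truncatedCost_le_iff hX hR hν hγ,
      transportLagrangian]
    constructor <;> intro h <;> linarith
  have hcl : ∀ g, IsClosed (D g) := fun g => isClosed_iInter fun N =>
    isClosed_le (ProbabilityMeasure.continuous_integral_boundedContinuousFunction _)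
      (continuous_const.sub (ProbabilityMeasure.continuous_integral_boundedContinuousFunction
        (g.compContinuous ⟨Prod.fst, continuous_fst⟩)))
  obtain ⟨γ, hγ, hγD⟩ := (isCompact_setOf_map_snd_eq hX (ν := ν)).inter_iInter_nonempty D hcl
    fun u => by
      obtain ⟨γ, hγ, h⟩ := exists_transportLagrangian_le hX hne hν m hab ha u
      exact ⟨γ, hγ, mem_iInter₂.mpr fun g hg => (hD g γ hγ).mpr (h g hg)⟩
  have hL : ∀ g, transportLagrangian m γ g ≤ b := fun g =>
    (hD g γ hγ).mp (mem_iInter.mp hγD g)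
  refine ⟨γ, ⟨inferInstance, ?_, hγ⟩, ?_⟩
  · refine ext_of_forall_integral_eq_of_IsFiniteMeasure fun g => ?_
    rw [integral_map measurable_fst.aemeasurable g.continuous.aestronglyMeasurable]
    by_contra hg
    rw [← sub_eq_zero, ← ne_eq] at hg
    -- If the integrals of `g` differ, this multiple of `g` makes the Lagrangian equal to `b + 1`.
    have := hL (((b - ∫ p, innerCost X p ∂(γ : Measure (X × EuclideanSpace ℝ (Fin n))) + 1) /
      (∫ p, g p.1 ∂(γ : Measure (X × EuclideanSpace ℝ (Fin n))) - ∫ x, g x ∂m)) • g)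
    rw [transportLagrangian_smul, div_mul_cancel₀ _ hg] at this
    linarith
  · simpa [transportLagrangian] using hL 0

end Kantorovich

/-! ### Legendre duality between `J_ν` and the transport functional -/

section Duality

variable {n : ℕ} {X : Set (EuclideanSpace ℝ (Fin n))}
  {ν : Measure (EuclideanSpace ℝ (Fin n))}

theorem W22_of_eq {μ : SignedMeasure X} {m : ProbabilityMeasure X}
    (h : μ = (m : Measure X).toSignedMeasure) : W22 X ν μ = transportCost X m ν := by
  rw [h, W22_probabilityMeasure]

theorem nonpos_of_forall_mul_le {a b : ℝ} (h : ∀ t, 0 ≤ t → t * a ≤ b) : a ≤ 0 := by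
  by_contra! ha
  have := h ((|b| + 1) / a) (by positivity)
  rw [div_mul_cancel₀ _ ha.ne'] at this
  linarith [le_abs_self b]

theorem legendreTransform_JFunctional_le_iff {μ : SignedMeasure X} {b : ℝ} :
    legendreTransform measurePairing (fun f => (JFunctional X ν f : EReal)) μ ≤ (b : EReal) ↔
      ∀ g : X →ᵇ ℝ, measurePairing g μ - JFunctional X ν g ≤ b := by
  simp only [legendreTransform, iSup_le_iff, ← EReal.coe_sub, EReal.coe_le_coe_iff]

/-- Constants of both signs force total mass `-1`. For `g ≥ 0` and `t ≥ 0`, `J_ν(t g) ≤ J_ν(0)`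
keeps `t⟨g, μ⟩` bounded above, so `⟨g, μ⟩ ≤ 0`. -/
theorem exists_probabilityMeasure_eq_neg (hX : IsCompact X) (hne : X.Nonempty)
    [IsProbabilityMeasure ν] (hν : Integrable (fun y => ‖y‖) ν) {μ : SignedMeasure X} {b : ℝ}
    (h : ∀ g : X →ᵇ ℝ, measurePairing g μ - JFunctional X ν g ≤ b) :
    ∃ m : ProbabilityMeasure X, (m : Measure X).toSignedMeasure = -μ := by
  have hc : ∀ c : ℝ, c * (μ univ + 1) ≤ b + JFunctional X ν 0 := fun c => by
    have h1 := h (BoundedContinuousFunction.const X c)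
    have h2 := JFunctional_const_le hX hne hν c
    rw [const_measurePairing] at h1
    linarith
  have h1 : μ univ + 1 ≤ 0 := nonpos_of_forall_mul_le fun t _ => hc t
  have h2 : -(μ univ + 1) ≤ 0 := nonpos_of_forall_mul_le fun t _ => by
    have := hc (-t)
    rwa [neg_mul, ← mul_neg] at this
  obtain ⟨q, hq, hμq⟩ := exists_eq_neg_toSignedMeasure (μ := μ) fun g hg =>
    nonpos_of_forall_mul_le (b := b + JFunctional X ν 0) fun t ht => by
      have h3 := h (t • g)
      have h4 : JFunctional X ν (t • g) ≤ JFunctional X ν 0 :=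
        JFunctional_anti hX hne hν fun x => mul_nonneg ht (hg x)
      rw [smul_measurePairing] at h3
      linarith
  refine ⟨⟨q, isProbabilityMeasure_iff_real.mpr ?_⟩, hμq.symm⟩
  rw [← Measure.toSignedMeasure_apply_measurable .univ, ← hμq, neg_apply]
  linarith

theorem legendreTransform_JFunctional (hX : IsCompact X) (hne : X.Nonempty)
    [IsProbabilityMeasure ν] (hν : Integrable (fun y => ‖y‖) ν) (μ : SignedMeasure X) :
    legendreTransform measurePairing (fun f => (JFunctional X ν f : EReal)) μ = W22 X ν (-μ) := by
  by_cases hm : ∃ m : ProbabilityMeasure X, (m : Measure X).toSignedMeasure = -μ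
  · obtain ⟨m, hm⟩ := hm
    have hp : ∀ g : X →ᵇ ℝ, measurePairing g μ = -∫ x, g x ∂(m : Measure X) := fun g => by
      rw [← neg_neg μ, measurePairing_neg, ← hm, measurePairing_toSignedMeasure]
    rw [W22_of_eq hm.symm]
    refine le_antisymm (iSup_le fun g => le_iInf₂ fun γ hγ => ?_) ?_
    · rw [← EReal.coe_sub, EReal.coe_le_coe_iff, hp]
      linarith [neg_integral_innerCost_sub_le hX hne hν g hγ]
    · refine EReal.le_of_forall_lt_iff_le.mp fun b hb => ?_
      obtain ⟨a, ha, hab⟩ := EReal.lt_iff_exists_real_btwn.mp hb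
      obtain ⟨γ, hγ, hγb⟩ := exists_transportPlan_integral_le hX hne hν (m : Measure X)
        (EReal.coe_lt_coe_iff.mp hab) fun g => by
          rw [← hp]
          exact legendreTransform_JFunctional_le_iff.mp ha.le g
      exact (iInf₂_le γ hγ).trans (EReal.coe_le_coe_iff.mpr hγb)
  · rw [W22, dif_neg hm]
    by_contra htop
    obtain ⟨b, hb, -⟩ := EReal.lt_iff_exists_real_btwn.mp (lt_top_iff_ne_top.mpr htop)
    exact hm (exists_probabilityMeasure_eq_neg hX hne hν
      (legendreTransform_JFunctional_le_iff.mp hb.le))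

theorem eConvex_W22_neg (hX : IsCompact X) (hne : X.Nonempty)
    [IsProbabilityMeasure ν] (hν : Integrable (fun y => ‖y‖) ν) :
    EConvex (fun μ : SignedMeasure X => W22 X ν (-μ)) := by
  rintro ⟨μ, r⟩ hμ ⟨ρ, s⟩ hρ a b ha hb hab
  simp only [mem_ofPred_eq, ← legendreTransform_JFunctional hX hne hν,
    legendreTransform_JFunctional_le_iff, Prod.smul_mk, Prod.mk_add_mk, smul_eq_mul,
    measurePairing_add, measurePairing_smul] at *
  intro g
  have h1 := mul_le_mul_of_nonneg_left (hμ g) ha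
  have h2 := mul_le_mul_of_nonneg_left (hρ g) hb
  linear_combination h1 + h2 + (JFunctional X ν g) * hab

theorem lowerSemicontinuous_W22_neg (hX : IsCompact X) (hne : X.Nonempty)
    [IsProbabilityMeasure ν] (hν : Integrable (fun y => ‖y‖) ν) :
    @LowerSemicontinuous _ _ (weakMeasureTopology X) _
      (fun μ : SignedMeasure X => W22 X ν (-μ)) := by
  let := weakMeasureTopology X
  simp only [← legendreTransform_JFunctional hX hne hν, legendreTransform, ← EReal.coe_sub]
  refine lowerSemicontinuous_iSup fun g => Continuous.lowerSemicontinuous ?_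
  have h : Continuous fun μ : SignedMeasure X => measurePairing g μ :=
    continuous_pi_iff.mp (continuous_induced_dom
      (f := fun (μ : SignedMeasure X) (f : X →ᵇ ℝ) => measurePairing f μ)) g
  exact continuous_coe_real_ereal.comp (h.sub continuous_const)

theorem legendreTransform_W22_neg (hX : IsCompact X) (hne : X.Nonempty)
    [IsProbabilityMeasure ν] (hν : Integrable (fun y => ‖y‖) ν) (f : X →ᵇ ℝ) :
    legendreTransform (fun (μ : SignedMeasure X) (g : X →ᵇ ℝ) => measurePairing g μ)
      (fun μ => W22 X ν (-μ)) f = (JFunctional X ν f : EReal) := by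
  refine le_antisymm (iSup_le fun μ => ?_) (EReal.ge_of_forall_gt_iff_ge.mp fun z hz => ?_)
  · have h : ((measurePairing f μ : ℝ) : EReal) - (JFunctional X ν f : EReal) ≤ W22 X ν (-μ) := by
      rw [← legendreTransform_JFunctional hX hne hν]
      exact le_iSup (fun g : X →ᵇ ℝ =>
        ((measurePairing g μ : ℝ) : EReal) - (JFunctional X ν g : EReal)) f
    rw [← EReal.coe_sub] at h
    change ((measurePairing f μ : ℝ) : EReal) - W22 X ν (-μ) ≤ _
    -- Swapping the two terms of the Fenchel–Young inequality in `EReal` needs the infinite values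
    -- treated separately.
    generalize W22 X ν (-μ) = W at *
    induction W using EReal.rec with
    | bot => exact absurd (le_bot_iff.mp h) (EReal.coe_ne_bot _)
    | top => simp
    | coe w =>
      rw [EReal.coe_le_coe_iff] at h
      rw [← EReal.coe_sub, EReal.coe_le_coe_iff]
      linarith
  · rw [EReal.coe_lt_coe_iff] at hz
    obtain ⟨m, γ, hγ, hJ⟩ := exists_transportPlan_lt hX hne hν f (sub_pos.mpr hz)
    refine le_trans ?_ (le_iSup (fun μ : SignedMeasure X =>
      ((measurePairing f μ : ℝ) : EReal) - W22 X ν (-μ)) (-(m : Measure X).toSignedMeasure))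
    have h : W22 X ν (m : Measure X).toSignedMeasure ≤
        ((∫ p, innerCost X p ∂γ : ℝ) : EReal) := by
      rw [W22_probabilityMeasure]
      exact iInf₂_le γ hγ
    simp only [neg_neg, measurePairing_neg, measurePairing_toSignedMeasure]
    refine le_trans ?_ (EReal.sub_le_sub le_rfl h)
    rw [← EReal.coe_sub, EReal.coe_le_coe_iff]
    linarith

/-- The product plan bounds the cost above; weak duality at `f = 0` bounds it below. -/
theorem exists_W22_probabilityMeasure_eq_coe (hX : IsCompact X) (hne : X.Nonempty)
    [IsProbabilityMeasure ν] (hν : Integrable (fun y => ‖y‖) ν) (m : ProbabilityMeasure X) :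
    ∃ r : ℝ, W22 X ν (m : Measure X).toSignedMeasure = (r : EReal) := by
  have hprod : (m : Measure X).prod ν ∈ transportPlans (m : Measure X) ν :=
    ⟨inferInstance, by simp, by simp⟩
  rw [W22_probabilityMeasure]
  have h1 : transportCost X m ν ≠ ⊤ :=
    ((iInf₂_le _ hprod).trans_lt (EReal.coe_lt_top _)).ne
  have h2 : transportCost X m ν ≠ ⊥ := by
    have : ((-JFunctional X ν 0 : ℝ) : EReal) ≤ transportCost X m ν :=
      le_iInf₂ fun γ hγ => by
        have := neg_integral_innerCost_sub_le hX hne hν 0 hγ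
        have h0 : ∫ x, (0 : X →ᵇ ℝ) x ∂(m : Measure X) = 0 := integral_zero _ _
        rw [EReal.coe_le_coe_iff]
        linarith
    exact ((EReal.bot_lt_coe _).trans_le this).ne'
  exact ⟨_, (EReal.coe_toReal h1 h2).symm⟩

end Duality

/-! ### Differentiability of `J_ν` and the Monge–Ampère measure -/

section Gateaux

open Filter Topology

variable {n : ℕ} {X : Set (EuclideanSpace ℝ (Fin n))}
  {ν : Measure (EuclideanSpace ℝ (Fin n))}

theorem abs_legendreOn_sub_le (hX : IsCompact X) (hne : X.Nonempty) (f g : X →ᵇ ℝ)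
    (y : EuclideanSpace ℝ (Fin n)) :
    |legendreOn X f y - legendreOn X g y| ≤ ‖f - g‖ := by
  have h1 := legendreOn_le_add_norm_sub hX hne f g y
  have h2 := legendreOn_le_add_norm_sub hX hne g f y
  rw [norm_sub_rev] at h2
  rw [abs_le]
  constructor <;> linarith

theorem abs_legendreOn_add_smul_sub_le (hX : IsCompact X) (hne : X.Nonempty) (f g : X →ᵇ ℝ)
    (y : EuclideanSpace ℝ (Fin n)) (s t : ℝ) :
    |legendreOn X (f + s • g : X →ᵇ ℝ) y - legendreOn X (f + t • g : X →ᵇ ℝ) y| ≤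
      ‖g‖ * |s - t| := by
  refine (abs_legendreOn_sub_le hX hne _ _ y).trans_eq ?_
  have h : s • g - t • g = (s - t) • g := (sub_smul s t g).symm
  rw [add_sub_add_left_eq_sub, h, norm_smul, Real.norm_eq_abs, mul_comm]

/-- Envelope theorem: the maximizers `u t` for `f + t g` converge to the unique maximizer `x₀`, and
comparing `u t` with `x₀` in both problems squeezes the increment. -/
theorem hasDerivAt_legendreOn_add_smul (hX : IsCompact X) (hne : X.Nonempty) (f g : X →ᵇ ℝ)
    {y : EuclideanSpace ℝ (Fin n)} {x₀ : X}
    (hx₀ : ∀ x : X, legendreOn X f y = inner ℝ (x : EuclideanSpace ℝ (Fin n)) y - f x ↔ x = x₀) :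
    HasDerivAt (fun t : ℝ => legendreOn X (f + t • g : X →ᵇ ℝ) y) (-g x₀) 0 := by
  have := isCompact_iff_compactSpace.mp hX
  choose u hu using fun t : ℝ => exists_legendreOn_eq hX hne (f + t • g) y
  have hf : ∀ t x, (f + t • g : X →ᵇ ℝ) x = f x + t * g x := fun t x => rfl
  have hz : (f + (0 : ℝ) • g : X →ᵇ ℝ) = f := by rw [zero_smul, add_zero]
  simp only [hf] at hu
  have hlim : Tendsto u (𝓝 0) (𝓝 x₀) := by
    refine isCompact_univ.tendsto_nhds_of_unique_mapClusterPt (.of_forall fun t => mem_univ _)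
      fun z _ hz' => (hx₀ z).mp ?_
    refine le_antisymm (not_lt.mp fun hlt => ?_) (inner_sub_le_legendreOn hX f y z)
    obtain ⟨c, hc1, hc2⟩ := exists_between hlt
    have ho : ∀ᶠ x : X in 𝓝 z, inner ℝ (x : EuclideanSpace ℝ (Fin n)) y - f x < c :=
      (isOpen_lt (by fun_prop) continuous_const).mem_nhds hc1
    -- One `‖g‖ * |t|` pays for the change of the supremum, the other for the term `t * g (u t)`.
    have htend : Tendsto (fun t : ℝ => legendreOn X f y - 2 * (‖g‖ * |t|)) (𝓝 0)
        (𝓝 (legendreOn X f y)) := by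
      have : Continuous fun t : ℝ => legendreOn X f y - 2 * (‖g‖ * |t|) := by fun_prop
      simpa using this.tendsto 0
    obtain ⟨t, ht1, ht2⟩ := ((hz'.frequently ho).and_eventually
      (htend.eventually (lt_mem_nhds hc2))).exists
    have h1 := (abs_le.mp (abs_legendreOn_add_smul_sub_le hX hne f g y t 0)).1
    rw [hz, hu, sub_zero] at h1
    have h2 : |t * g (u t)| ≤ ‖g‖ * |t| := by
      rw [abs_mul, mul_comm]
      exact mul_le_mul_of_nonneg_right (g.norm_coe_le_norm _) (abs_nonneg t)
    have h3 := (abs_le.mp h2).1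
    linarith
  rw [hasDerivAt_iff_isLittleO]
  simp only [hz, sub_zero, smul_eq_mul]
  refine Asymptotics.isLittleO_iff.mpr fun c hc => ?_
  have hgu : ∀ᶠ t in 𝓝 (0 : ℝ), |g (u t) - g x₀| < c :=
    Metric.tendsto_nhds.mp ((g.continuous.tendsto x₀).comp hlim) c hc
  filter_upwards [hgu] with t ht
  have hx := (hx₀ x₀).mpr rfl
  have h1 := inner_sub_le_legendreOn hX (f + t • g) y x₀
  have h2 := inner_sub_le_legendreOn hX f y (u t)
  have h3 : t * (g x₀ - g (u t)) ≤ c * |t| := by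
    rw [mul_comm]
    refine (le_abs_self _).trans ?_
    rw [abs_mul, abs_sub_comm]
    exact mul_le_mul_of_nonneg_right ht.le (abs_nonneg t)
  -- By `h1` the remainder is nonnegative; by `h2` it is at most `t * (g x₀ - g (u t))`, for either
  -- sign of `t`.
  rw [hf] at h1
  rw [Real.norm_eq_abs, Real.norm_eq_abs, abs_of_nonneg (by linarith), hu]
  linarith

theorem measurable_gradient {E : Type*} [NormedAddCommGroup E] [InnerProductSpace ℝ E]
    [CompleteSpace E] [MeasurableSpace E] [BorelSpace E] (f : E → ℝ) :
    Measurable (gradient f) :=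
  (InnerProductSpace.toDual ℝ E).symm.continuous.measurable.comp (measurable_fderiv ℝ f)

/-- The gradient takes values in `X` only almost everywhere. Sending the remaining points to an
arbitrary point of `X` gives a genuine map into `X` and turns the comap into a pushforward. -/
theorem exists_measurable_eq_gradient (hX : IsCompact X) (hne : X.Nonempty) (f : X →ᵇ ℝ)
    (hd : ∀ᵐ y ∂ν, DifferentiableAt ℝ (legendreOn X f) y) :
    ∃ T : EuclideanSpace ℝ (Fin n) → X, Measurable T ∧
      (∀ᵐ y ∂ν, gradient (legendreOn X f) y = T y) ∧ mongeAmpere X ν f = ν.map T := by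
  classical
  obtain ⟨x₀, hx₀⟩ := hne
  let T : EuclideanSpace ℝ (Fin n) → X := fun y =>
    ⟨if gradient (legendreOn X f) y ∈ X then gradient (legendreOn X f) y else x₀, by
      split_ifs with h
      exacts [h, hx₀]⟩
  have hT : Measurable T := (Measurable.ite ((measurable_gradient _) hX.measurableSet)
    (measurable_gradient _) measurable_const).subtype_mk
  have hae : ∀ᵐ y ∂ν, gradient (legendreOn X f) y = T y := by
    filter_upwards [hd] with y hy
    obtain ⟨x, hx⟩ := exists_legendreOn_eq hX ⟨x₀, hx₀⟩ f y
    have h := gradient_legendreOn_eq hX f hy hx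
    have hmem : gradient (legendreOn X f) y ∈ X := h ▸ x.2
    simp only [T, if_pos hmem]
  refine ⟨T, hT, hae, ?_⟩
  rw [mongeAmpere, Measure.map_congr hae]
  have : (ν.map fun y => (T y : EuclideanSpace ℝ (Fin n))) = (ν.map T).map Subtype.val :=
    (Measure.map_map measurable_subtype_coe hT).symm
  rw [this]
  exact (MeasurableEmbedding.subtype_coe hX.measurableSet).comap_map _

theorem hasLineDerivAt_JFunctional (hX : IsCompact X) (hne : X.Nonempty)
    [IsProbabilityMeasure ν] (hν : Integrable (fun y => ‖y‖) ν) (f g : X →ᵇ ℝ)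
    (hd : ∀ᵐ y ∂ν, DifferentiableAt ℝ (legendreOn X f) y) :
    HasLineDerivAt ℝ (JFunctional X ν) (-∫ x, g x ∂(mongeAmpere X ν f)) f g := by
  obtain ⟨T, hT, hTg, hMA⟩ := exists_measurable_eq_gradient hX hne f hd
  rw [hMA, integral_map hT.aemeasurable g.continuous.aestronglyMeasurable, ← integral_neg]
  refine (hasDerivAt_integral_of_dominated_loc_of_lip (bound := fun _ => ‖g‖) univ_mem
    (.of_forall fun t => (integrable_legendreOn hX hne hν _).1) (integrable_legendreOn hX hne hν _)
    (g.continuous.measurable.comp hT).neg.aestronglyMeasurable (.of_forall fun y => ?_)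
    (integrable_const _) ?_).2
  · refine LipschitzWith.lipschitzOnWith (LipschitzWith.of_dist_le_mul fun s t => ?_)
    rw [Real.dist_eq, Real.dist_eq, Real.coe_nnabs, abs_norm]
    exact abs_legendreOn_add_smul_sub_le hX hne f g y s t
  · filter_upwards [hd, hTg] with y hy hTy
    have hmax : ∀ x : X, legendreOn X f y = inner ℝ (x : EuclideanSpace ℝ (Fin n)) y - f x →
        x = T y := fun x hx =>
      Subtype.ext ((gradient_legendreOn_eq hX f hy hx).symm.trans hTy)
    refine hasDerivAt_legendreOn_add_smul hX hne f g fun x => ⟨hmax x, ?_⟩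
    rintro rfl
    obtain ⟨x, hx⟩ := exists_legendreOn_eq hX hne f y
    rwa [← hmax x hx]

theorem exists_hasGateauxDerivAt_JFunctional (hX : IsCompact X) (hne : X.Nonempty)
    [IsProbabilityMeasure ν] (hν : Integrable (fun y => ‖y‖) ν) (f : X →ᵇ ℝ)
    (hd : ∀ᵐ y ∂ν, DifferentiableAt ℝ (legendreOn X f) y) :
    IsProbabilityMeasure (mongeAmpere X ν f) ∧
      (mongeAmpere X ν f).map Subtype.val = ν.map (gradient (legendreOn X f)) ∧
      ∃ L : (X →ᵇ ℝ) →L[ℝ] ℝ,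
        (∀ g : X →ᵇ ℝ, L g = -∫ x, g x ∂(mongeAmpere X ν f)) ∧
        HasGateauxDerivAt (JFunctional X ν) L f := by
  obtain ⟨T, hT, hTg, hMA⟩ := exists_measurable_eq_gradient hX hne f hd
  have hp : IsProbabilityMeasure (mongeAmpere X ν f) := by
    rw [hMA]
    exact Measure.isProbabilityMeasure_map hT.aemeasurable
  refine ⟨hp, ?_, ?_⟩
  · rw [hMA, Measure.map_map measurable_subtype_coe hT]
    exact (Measure.map_congr hTg).symm
  · let L : (X →ᵇ ℝ) →ₗ[ℝ] ℝ :=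
      { toFun := fun g => -∫ x, g x ∂(mongeAmpere X ν f)
        map_add' := fun g h => by
          simp only [BoundedContinuousFunction.add_apply]
          rw [integral_add (g.integrable _) (h.integrable _), neg_add]
        map_smul' := fun c g => by
          simp only [BoundedContinuousFunction.smul_apply, smul_eq_mul, integral_const_mul,
            RingHom.id_apply, mul_neg] }
    exact ⟨L.mkContinuous 1 fun g => by
        rw [one_mul]
        exact (norm_neg _).trans_le (g.norm_integral_le_norm _),
      fun g => rfl, fun g => hasLineDerivAt_JFunctional hX hne hν f g hd⟩

end Gateaux

theorem theorem7p6 (n : ℕ) (X : Set (EuclideanSpace ℝ (Fin n)))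
    (hXc : IsCompact X) (hXne : X.Nonempty)
    (ν : Measure (EuclideanSpace ℝ (Fin n))) (hν : IsProbabilityMeasure ν)
    (hmom : Integrable (fun y => ‖y‖) ν) :
    -- the two functionals are well defined: `f^⋆` is a finite supremum, `J_ν(f)` a convergent
    -- integral, and `W_2^2(μ, ν)` is a real number for every probability measure `μ` on `X`
    (∀ f : X →ᵇ ℝ,
      (∀ y, BddAbove (range fun x : X =>
        inner ℝ (x : EuclideanSpace ℝ (Fin n)) y - f x)) ∧
      Integrable (legendreOn X f) ν) ∧
    (∀ m : ProbabilityMeasure X,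
      (∀ γ ∈ transportPlans (m : Measure X) ν, Integrable (innerCost X) γ) ∧
      ∃ r : ℝ, W22 X ν (m : Measure X).toSignedMeasure = (r : EReal)) ∧
    -- convexity and lower semicontinuity
    ConvexOn ℝ univ (JFunctional X ν) ∧
    LowerSemicontinuous (JFunctional X ν) ∧
    EConvex (fun μ : SignedMeasure X => W22 X ν (-μ)) ∧
    @LowerSemicontinuous _ _ (weakMeasureTopology X) _
      (fun μ : SignedMeasure X => W22 X ν (-μ)) ∧
    -- Legendre duality, in both directions
    (∀ μ : SignedMeasure X,
      legendreTransform measurePairing (fun f => (JFunctional X ν f : EReal)) μ =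
        W22 X ν (-μ)) ∧
    (∀ f : X →ᵇ ℝ,
      legendreTransform (fun (μ : SignedMeasure X) (g : X →ᵇ ℝ) => measurePairing g μ)
        (fun μ => W22 X ν (-μ)) f = (JFunctional X ν f : EReal)) ∧
    -- if `ν` is absolutely continuous, `∇ f^⋆` exists `ν`-almost everywhere for every `f`
    (ν ≪ volume → ∀ f : X →ᵇ ℝ, ∀ᵐ y ∂ν, DifferentiableAt ℝ (legendreOn X f) y) ∧
    -- whenever `∇ f^⋆` exists `ν`-almost everywhere, `MA_ν f` is a probability measure on `X`
    -- and `J_ν` is Gateaux differentiable at `f` with derivative `-MA_ν f`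
    (∀ f : X →ᵇ ℝ, (∀ᵐ y ∂ν, DifferentiableAt ℝ (legendreOn X f) y) →
      IsProbabilityMeasure (mongeAmpere X ν f) ∧
      (mongeAmpere X ν f).map Subtype.val = ν.map (gradient (legendreOn X f)) ∧
      ∃ L : (X →ᵇ ℝ) →L[ℝ] ℝ,
        (∀ g : X →ᵇ ℝ, L g = -∫ x, g x ∂(mongeAmpere X ν f)) ∧
        HasGateauxDerivAt (JFunctional X ν) L f) := by
  obtain ⟨R, hR⟩ := exists_norm_le_of_isCompact hXc
  exact ⟨fun f => ⟨bddAbove_range_inner_sub hXc f, integrable_legendreOn hXc hXne hmom f⟩,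
    fun m => ⟨fun γ hγ => integrable_innerCost hXc hmom hγ.2.2,
      exists_W22_probabilityMeasure_eq_coe hXc hXne hmom m⟩,
    convexOn_JFunctional hXc hXne hmom,
    (lipschitzWith_JFunctional hXc hXne hmom).continuous.lowerSemicontinuous,
    eConvex_W22_neg hXc hXne hmom, lowerSemicontinuous_W22_neg hXc hXne hmom,
    legendreTransform_JFunctional hXc hXne hmom, legendreTransform_W22_neg hXc hXne hmom,
    -- Rademacher's theorem, transferred from Lebesgue measure to `ν`.
    fun hac f => hac.ae_le (lipschitzWith_legendreOn hXc hXne hR f).ae_differentiableAt,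
    exists_hasGateauxDerivAt_JFunctional hXc hXne hmom⟩
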